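/- **Setting.** A network in a bounded measurable area $\mathcal A\subset\mathbb R^2$ has $n+1$ base stations: the macro cell $s=0$ and the small cells $s=1,\dots,n$. The parameter $P=(P_s)_{1\le s\le n}\in\mathbb R^n$ collects the pilot power plus cell individual offset (CIO) of the small cells; the value $P_0$ of the macro cell is fixed. With $h_{s,r}>0$ the downlink gain from station $s$ to location $r$, the coverage area of station $s$ is $$\mathcal A_s(P)=\{r\in\mathcal A : h_{s,r}P_s=\max_{s'}h_{s',r}P_{s'}\}.$$ There are $N_{PRB}\ge1$ resource blocks of bandwidth $W>0$, and the noise density is $N_0>0$. For each $P$ there is a finite set of active users, each with a set of resource blocks used in the uplink. A user at $r$ served by $s$ on $M$ blocks transmits, on the dB scale, with total power $\min\{P_{\max},\,P_{0,s,r}+10\log_{10}M+\alpha_s L_{s,r}+\Delta_r\}$, where $L_{s,r}=-10\log_{10}h_{s,r}$ and the other symbols are given parameters; on the linear scale this power is split equally over the $M$ blocks, and the power on all other blocks is $0$. Let $SU^{(k)}_{r,s}(P)$ be the uplink ratio of received power to $WN_0$ plus interference at station $s$ on block $k$, for a user at $r$ served by $s$ on all blocks, where the interferers are the active users in $\mathcal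 A_{s'}(P)$, $s'\ne s$ (uplink gains $h_{r,s}>0$). Given a spectral efficiency function $\phi$ with $0\le\phi(x)\le\log_2(1+x)$ for $x\ge 0$ and a fading density $p_\xi$ on $(0,\infty)$, the peak uplink rate and the uplink load are $$R_s(r,P)=\sum_k W\int_0^\infty\phi(SU^{(k)}_{r,s}(P)\,x)\,p_\xi(x)\,dx,\qquad \bar\rho_s(P)=\int_{\mathcal A_s(P)}\frac{\lambda(r)\,\mathbb E(\sigma_U)}{R_s(r,P)}\,dr\in[0,\infty],$$ where $\lambda\ge0$ is the arrival rate of users and $\mathbb E(\sigma_U)<\infty$ the mean size of an uploaded file. With downlink powers $p_s^{(k)}\ge0$, the downlink ratio is $SD^{(k)}_{r,s}=p_s^{(k)}h_{s,r}/(WN_0+\sum_{s'\ne s}p_{s'}^{(k)}h_{s',r})$. The outage $\theta_s(P)\in[0,1]$ is the proportion, among the pairs of an active user $r$ in $\mathcal A_s(P)$ and a block $k$, of those for which $SD^{(k)}_{r,s}$ is below a given threshold ($\theta_s(P)=0$ if there is no such user). All these data are arbitrary (functions of locations being measurable), except that the uplink loads satisfy $\bar\rho_s(P)\le1$ for all $P$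 and all $s=0,\dots,n$. Given an outage threshold $\bar\theta\in\mathbb R$, define $h:\mathbb R^n\to\mathbb R^n$ by $$h_s(P)=\begin{cases}\bar\rho_0(P)-\bar\rho_s(P)&\text{if }\theta_s(P)<\bar\theta,\\ \bar\theta-\theta_s(P)&\text{otherwise,}\end{cases}\qquad s=1,\dots,n,$$ and, with $\overline{\mathrm{co}}$ the closed convex hull, let $$g(P)=\bigcap_{\gamma>0}\overline{\mathrm{co}}\,\{h(P') : \|P'-P\|<\gamma\}.$$ **Proposition 1.** (a) $h(P)\in g(P)$ for every $P\in\mathbb R^n$. Consequently the load-balancing iteration $P(t+1)=P(t)+\varepsilon\,h(P(t))$ is a special case of the recursive inclusion $$P(t+1)=P(t)+\varepsilon\,y(t),\qquad y(t)\in g(P(t)),\qquad t=0,1,2,\dots\qquad(\ast)$$ that is, for every $\varepsilon$, each sequence that satisfies the iteration satisfies $(\ast)$. (b) The differential inclusion $\dot P\in g(P)$ is the limit of $(\ast)$ as the step size tends to $0$, in the following sense. Let $\varepsilon_k>0$ with $\varepsilon_k\to0$, let $P^k$ be any trajectory of $(\ast)$ with step $\varepsilon_k$, and let $X^k:[0,\infty)\to\mathbb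 R^n$ be the piecewise affine interpolation with $X^k(\varepsilon_k t)=P^k(t)$, $t=0,1,2,\dots$. If $X^k\to x$ uniformly on compact subsets of $[0,\infty)$, then $x$ solves the differential inclusion: it is absolutely continuous on compact intervals and $\dot x(\tau)\in g(x(\tau))$ for almost every $\tau\ge0$. If the initial values $P^k(0)$ are bounded, then some subsequence of $(X^k)$ converges uniformly on compact subsets of $[0,\infty)$. -/

import Mathlib

open MeasureTheory Filter Topology
open scoped NNReal ENNReal

noncomputable section

/-! ### The heterogeneous network -/

/-- Locations in the plane. -/
abbrev Location : Type := EuclideanSpace ℝ (Fin 2)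

/-- The vector `P = (P_s)` of the pilot power plus cell individual offset of each of the `n` small
cells. -/
abbrev Param (n : ℕ) : Type := EuclideanSpace ℝ (Fin n)

/-- A network with `n + 1` base stations: station `0` is the macro cell, station `s.succ` is the
small cell `s`. Powers and gains are linear, except for the quantities marked dB. -/
structure HetNet (n : ℕ) where
  /-- the served area -/
  area : Set Location
  area_bounded : Bornology.IsBounded area
  area_measurable : MeasurableSet area
  /-- number of physical resource blocks (PRBs) of each station -/
  numPRB : ℕ
  numPRB_pos : 0 < numPRB
  /-- bandwidth of one PRB -/
  prbBandwidth : ℝ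
  prbBandwidth_pos : 0 < prbBandwidth
  /-- thermal noise spectral power density -/
  noise : ℝ
  noise_pos : 0 < noise
  /-- uplink gain from a location to a station -/
  ulGain : Fin (n + 1) → Location → ℝ
  ulGain_pos : ∀ s r, 0 < ulGain s r
  ulGain_measurable : ∀ s, Measurable (ulGain s)
  /-- downlink gain from a station to a location -/
  dlGain : Fin (n + 1) → Location → ℝ
  dlGain_pos : ∀ s r, 0 < dlGain s r
  dlGain_measurable : ∀ s, Measurable (dlGain s)
  /-- maximal transmit power of a terminal (dB) -/
  maxTxPower : ℝ
  /-- user- or cell-specific power control parameter `P₀` (dB) -/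
  basePower : Fin (n + 1) → Location → ℝ
  basePower_measurable : ∀ s, Measurable (basePower s)
  /-- cell-specific pathloss compensation factor `α` -/
  compensation : Fin (n + 1) → ℝ
  /-- modulation and closed-loop correction `Δ_mcs + f(Δ_r)` (dB) -/
  correction : Location → ℝ
  correction_measurable : Measurable correction
  /-- downlink data power of a station on a PRB -/
  dlPower : Fin (n + 1) → Fin numPRB → ℝ≥0
  /-- locations of the active users when the parameter vector is `P` -/
  users : Param n → Finset Location
  /-- PRBs used in the uplink by the active user at a location -/
  alloc : Param n → Location → Finset (Fin numPRB)
  /-- spectral efficiency as a function of the signal to interference plus noise ratio -/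
  spectralEff : ℝ → ℝ
  spectralEff_measurable : Measurable spectralEff
  spectralEff_nonneg : ∀ x, 0 ≤ x → 0 ≤ spectralEff x
  spectralEff_le : ∀ x, 0 ≤ x → spectralEff x ≤ Real.logb 2 (1 + x)
  /-- probability density of the channel fading -/
  fading : ℝ → ℝ≥0
  fading_measurable : Measurable fading
  fading_integral : ∫⁻ x in Set.Ioi (0 : ℝ), (fading x : ℝ≥0∞) = 1
  /-- arrival rate of users per surface element -/
  arrivalRate : Location → ℝ≥0
  arrivalRate_measurable : Measurable arrivalRate
  /-- mean size of an uploaded file -/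
  meanUpload : ℝ≥0
  /-- pilot power plus offset of the macro cell, which is not optimized -/
  macroPilot : ℝ
  /-- a user whose downlink ratio is below this value is in outage -/
  sinrThreshold : ℝ
  /-- the outage level tolerated by the operator -/
  outageThreshold : ℝ

namespace HetNet

variable {n : ℕ} (net : HetNet n)

/-- Pilot power plus offset of every station. -/
def pilot (P : Param n) : Fin (n + 1) → ℝ :=
  Fin.cons net.macroPilot (fun s => P s)

/-- Coverage area of station `s`: the locations for which `s` is a best server. -/
def coverage (P : Param n) (s : Fin (n + 1)) : Set Location :=
  {r ∈ net.area | ∀ s', net.dlGain s' r * net.pilot P s' ≤ net.dlGain s r * net.pilot P s}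

open Classical in
/-- The active users in the coverage area of station `s`. -/
def cellUsers (P : Param n) (s : Fin (n + 1)) : Finset Location :=
  (net.users P).filter (fun r => r ∈ net.coverage P s)

/-- Total uplink power of a user at `r` served by `s` with `M` resource blocks (fractional power
control in dB, converted to linear scale; `-10 log₁₀` of the downlink gain is the pathloss). -/
def txPower (s : Fin (n + 1)) (r : Location) (M : ℕ) : ℝ :=
  (10 : ℝ) ^ ((min net.maxTxPower
    (net.basePower s r + 10 * Real.logb 10 M
      + net.compensation s * (-10 * Real.logb 10 (net.dlGain s r)) + net.correction r)) / 10)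

/-- Uplink power on block `k` of a user at `r` served by `s` to whom the blocks in `K` are
allocated: the total power is split equally over `K`. -/
def txPowerOn (s : Fin (n + 1)) (r : Location) (K : Finset (Fin net.numPRB))
    (k : Fin net.numPRB) : ℝ :=
  if k ∈ K then net.txPower s r K.card / K.card else 0

/-- Uplink signal to interference plus noise ratio on block `k` of a user at `r` who is served by
`s` on all the blocks; the active users of the other cells interfere. -/
def ulSINR (P : Param n) (s : Fin (n + 1)) (r : Location) (k : Fin net.numPRB) : ℝ :=
  net.txPowerOn s r Finset.univ k * net.ulGain s r /
    (net.prbBandwidth * net.noise +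
      ∑ s' ∈ Finset.univ.erase s, ∑ r' ∈ net.cellUsers P s',
        net.txPowerOn s' r' (net.alloc P r') k * net.ulGain s r')

/-- Uplink peak rate at `r` in cell `s`, averaged over the fading. -/
def ulRate (P : Param n) (s : Fin (n + 1)) (r : Location) : ℝ≥0∞ :=
  ∑ k : Fin net.numPRB, ENNReal.ofReal net.prbBandwidth *
    ∫⁻ x in Set.Ioi (0 : ℝ),
      ENNReal.ofReal (net.spectralEff (net.ulSINR P s r k * x)) * (net.fading x : ℝ≥0∞)

/-- Uplink load of cell `s`. It is infinite where a positive demand meets a zero rate. -/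
def ulLoad (P : Param n) (s : Fin (n + 1)) : ℝ≥0∞ :=
  ∫⁻ r in net.coverage P s, (net.arrivalRate r * net.meanUpload : ℝ≥0∞) / net.ulRate P s r

/-- Downlink signal to interference plus noise ratio on block `k` at `r` in cell `s`. -/
def dlSINR (s : Fin (n + 1)) (r : Location) (k : Fin net.numPRB) : ℝ :=
  net.dlPower s k * net.dlGain s r /
    (net.prbBandwidth * net.noise +
      ∑ s' ∈ Finset.univ.erase s, (net.dlPower s' k : ℝ) * net.dlGain s' r)

open Classical in
/-- Downlink outage of cell `s`: the proportion of the active users of the cell (averaged over the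
resource blocks) whose downlink ratio is below the threshold; `0` in a cell without users. -/
def outage (P : Param n) (s : Fin (n + 1)) : ℝ :=
  (((net.cellUsers P s ×ˢ (Finset.univ : Finset (Fin net.numPRB))).filter
    (fun q => net.dlSINR s q.1 q.2 < net.sinrThreshold)).card : ℝ) /
      ((net.cellUsers P s).card * net.numPRB)

/-- The update direction `h(P)` of the load-balancing algorithm: balance the uplink loads of the
macro cell and the small cell while the outage is low, otherwise reduce the outage. -/
def drift (P : Param n) : Param n :=
  WithLp.toLp 2 fun s =>
    if net.outage P s.succ < net.outageThreshold then
      (net.ulLoad P 0).toReal - (net.ulLoad P s.succ).toReal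
    else net.outageThreshold - net.outage P s.succ

end HetNet

/-! ### Recursions and differential inclusions -/

section Dynamics

variable {E : Type*} [NormedAddCommGroup E] [NormedSpace ℝ E]

/-- The set-valued regularization
`g(p) = ⋂_{γ > 0} closed convex hull of {h(p') : ‖p' - p‖ < γ}`. -/
def regularization (h : E → E) (p : E) : Set E :=
  ⋂ (γ : ℝ) (_ : 0 < γ), closedConvexHull ℝ (h '' Metric.ball p γ)

/-- `P(t+1) = P(t) + ε h(P(t))`. -/
def IsIteration (h : E → E) (ε : ℝ) (P : ℕ → E) : Prop :=
  ∀ t, P (t + 1) = P t + ε • h (P t)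

/-- `P(t+1) = P(t) + ε y(t)` with `y(t) ∈ g(P(t))`. -/
def IsRecursiveInclusion (g : E → Set E) (ε : ℝ) (P : ℕ → E) : Prop :=
  ∃ y : ℕ → E, ∀ t, y t ∈ g (P t) ∧ P (t + 1) = P t + ε • y t

/-- The continuous piecewise affine path on `[0, ∞)` with value `P(t)` at time `ε t`. -/
def interpolate (ε : ℝ) (P : ℕ → E) (τ : ℝ) : E :=
  P ⌊τ / ε⌋₊ + (τ / ε - ⌊τ / ε⌋₊) • (P (⌊τ / ε⌋₊ + 1) - P ⌊τ / ε⌋₊)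

/-- `x` solves `dx/dτ ∈ g(x)` on `[0, ∞)`: it is absolutely continuous on compact intervals and
satisfies the inclusion at almost every time. -/
def IsDifferentialInclusionSolution (g : E → Set E) (x : ℝ → E) : Prop :=
  (∀ T : ℝ, 0 < T → AbsolutelyContinuousOnInterval x 0 T) ∧
    ∀ᵐ τ ∂(volume.restrict (Set.Ici (0 : ℝ))), ∃ v ∈ g (x τ), HasDerivAt x v τ

/-- Uniform convergence of paths on the compact subsets of `[0, ∞)`. -/
def PathTendsto (X : ℕ → ℝ → E) (x : ℝ → E) : Prop :=
  ∀ T : ℝ, 0 < T → TendstoUniformlyOn X x atTop (Set.Icc 0 T)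

/-- The differential inclusion `dx/dτ ∈ f(x)` is the limit of the recursive inclusion of `g` as the
step tends to `0`: along steps `ε k → 0`, every limit of interpolated trajectories solves the
differential inclusion, and interpolated trajectories with bounded initial values have a convergent
subsequence. -/
def IsLimitingDifferentialInclusion (g f : E → Set E) : Prop :=
  ∀ (ε : ℕ → ℝ) (P : ℕ → ℕ → E), (∀ k, 0 < ε k) → Tendsto ε atTop (𝓝 0) →
    (∀ k, IsRecursiveInclusion g (ε k) (P k)) →
    (∀ x : ℝ → E, PathTendsto (fun k => interpolate (ε k) (P k)) x →
      IsDifferentialInclusionSolution f x) ∧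
    (Bornology.IsBounded (Set.range fun k => P k 0) →
      ∃ (φ : ℕ → ℕ) (x : ℝ → E), StrictMono φ ∧
        PathTendsto (fun k => interpolate (ε (φ k)) (P (φ k))) x)

end Dynamics

end

/-! ### The regularization of a bounded map -/

section Dynamics

variable {E : Type*} [NormedAddCommGroup E] [NormedSpace ℝ E]

/-! Part (a) holds because `p` is the centre of every ball in the intersection. Part (b) uses only
that `h` is bounded, say by `C`; for the network this follows from loads and outages lying in `[0,
1]` (`HetNet.norm_drift_le`). The values of the regularization then lie in the ball of radius `C`,
so every interpolated trajectory is `C`-Lipschitz, whatever the step. Arzelà–Ascoli gives the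
convergent subsequence. For the inclusion, the mean velocity of a trajectory over a time window is
an average of velocities `y t`. In a window of length `δ` starting at `τ` the nodes stay within
about `C * δ` of `x τ`, so for `C * δ < γ` this mean lies in the closed convex hull of `h` over the
`γ`-ball at `x τ` (`slope_mem_closedConvexHull_of_tendsto_interpolate`). The hull is closed, so the
limit `k → ∞` and then `δ → 0` keep the derivative in it, for every `γ`. The limit path is
Lipschitz, hence differentiable almost everywhere. -/

theorem mem_regularization_self (h : E → E) (p : E) : h p ∈ regularization h p := by
  refine Set.mem_iInter₂.2 fun γ hγ => subset_closedConvexHull ?_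
  exact Set.mem_image_of_mem h (Metric.mem_ball_self hγ)

theorem regularization_subset_closedBall {h : E → E} {C : ℝ} (hC : ∀ p, ‖h p‖ ≤ C) (p : E) :
    regularization h p ⊆ Metric.closedBall 0 C := by
  intro v hv
  refine closedConvexHull_min ?_ (convex_closedBall 0 C) Metric.isClosed_closedBall
    (Set.mem_iInter₂.1 hv 1 one_pos)
  rintro _ ⟨q, -, rfl⟩
  simpa using hC q

/-- A smaller ball around `p` fits inside the one around `q`. This plays the role of upper
semicontinuity: near `q`, all values lie in one fixed closed convex set. -/
theorem regularization_subset_closedConvexHull (h : E → E) {p q : E} {γ : ℝ}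
    (hp : dist p q < γ) : regularization h p ⊆ closedConvexHull ℝ (h '' Metric.ball q γ) := by
  intro v hv
  refine (closedConvexHull ℝ).monotone (Set.image_mono ?_)
    (Set.mem_iInter₂.1 hv (γ - dist p q) (sub_pos.2 hp))
  exact Metric.ball_subset_ball' (by linarith)

theorem IsIteration.isRecursiveInclusion {h : E → E} {ε : ℝ} {P : ℕ → E}
    (hP : IsIteration h ε P) : IsRecursiveInclusion (regularization h) ε P :=
  ⟨fun t => h (P t), fun t => ⟨mem_regularization_self h (P t), hP t⟩⟩

/-! ### Trajectories with bounded increments -/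

theorem IsRecursiveInclusion.norm_succ_sub_le {h : E → E} {C ε : ℝ} {P : ℕ → E}
    (hC : ∀ p, ‖h p‖ ≤ C) (hε : 0 < ε) (hP : IsRecursiveInclusion (regularization h) ε P)
    (t : ℕ) : ‖P (t + 1) - P t‖ ≤ C * ε := by
  obtain ⟨y, hy⟩ := hP
  have hyt : ‖y t‖ ≤ C := by
    simpa using regularization_subset_closedBall hC _ (hy t).1
  rw [(hy t).2, add_sub_cancel_left, norm_smul, Real.norm_of_nonneg hε.le, mul_comm]
  gcongr

theorem norm_sub_le_of_norm_succ_sub_le {F : Type*} [NormedAddCommGroup F]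
    {P : ℕ → F} {D : ℝ}
    (hP : ∀ t, ‖P (t + 1) - P t‖ ≤ D) {a b : ℕ} (hab : a ≤ b) :
    ‖P b - P a‖ ≤ D * (b - a : ℝ) := by
  induction b, hab using Nat.le_induction with
  | base => simp
  | succ b _ ih =>
    calc ‖P (b + 1) - P a‖ = ‖(P (b + 1) - P b) + (P b - P a)‖ := by congr 1; abel
      _ ≤ D + D * (b - a : ℝ) := (norm_add_le _ _).trans (add_le_add (hP b) ih)
      _ = D * ((b + 1 : ℕ) - a : ℝ) := by push_cast; ring

theorem norm_interpolate_sub_floor_le {P : ℕ → E} {C ε : ℝ} (hε : 0 < ε)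
    (hP : ∀ t, ‖P (t + 1) - P t‖ ≤ C * ε) {τ : ℝ} (hτ : 0 ≤ τ) :
    ‖interpolate ε P τ - P ⌊τ / ε⌋₊‖ ≤ C * (τ - ε * ⌊τ / ε⌋₊) := by
  have hfl := Nat.floor_le (div_nonneg hτ hε.le)
  rw [interpolate, add_sub_cancel_left, norm_smul, Real.norm_of_nonneg (sub_nonneg.2 hfl)]
  calc _ ≤ (τ / ε - ⌊τ / ε⌋₊) * (C * ε) :=
        mul_le_mul_of_nonneg_left (hP _) (sub_nonneg.2 hfl)
    _ = _ := by field_simp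

theorem norm_interpolate_sub_floor_succ_le {P : ℕ → E} {C ε : ℝ} (hε : 0 < ε)
    (hP : ∀ t, ‖P (t + 1) - P t‖ ≤ C * ε) (τ : ℝ) :
    ‖P (⌊τ / ε⌋₊ + 1) - interpolate ε P τ‖ ≤ C * (ε * (⌊τ / ε⌋₊ + 1) - τ) := by
  have hfl := Nat.lt_floor_add_one (τ / ε)
  have heq : P (⌊τ / ε⌋₊ + 1) - interpolate ε P τ
      = (⌊τ / ε⌋₊ + 1 - τ / ε) • (P (⌊τ / ε⌋₊ + 1) - P ⌊τ / ε⌋₊) := by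
    rw [interpolate]; module
  rw [heq, norm_smul, Real.norm_of_nonneg (sub_nonneg.2 hfl.le)]
  calc _ ≤ (⌊τ / ε⌋₊ + 1 - τ / ε) * (C * ε) :=
        mul_le_mul_of_nonneg_left (hP _) (sub_nonneg.2 hfl.le)
    _ = _ := by field_simp

theorem norm_interpolate_sub_le {P : ℕ → E} {C ε : ℝ} (hε : 0 < ε)
    (hP : ∀ t, ‖P (t + 1) - P t‖ ≤ C * ε) {a b : ℝ} (ha : 0 ≤ a) (hab : a ≤ b) :
    ‖interpolate ε P b - interpolate ε P a‖ ≤ C * (b - a) := by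
  have hfl : ⌊a / ε⌋₊ ≤ ⌊b / ε⌋₊ := Nat.floor_le_floor (by gcongr)
  rcases hfl.eq_or_lt with heq | hlt
  · have h1 : interpolate ε P b - interpolate ε P a
        = ((b - a) / ε) • (P (⌊a / ε⌋₊ + 1) - P ⌊a / ε⌋₊) := by
      rw [interpolate, interpolate, ← heq, sub_div]; module
    rw [h1, norm_smul, Real.norm_of_nonneg (div_nonneg (sub_nonneg.2 hab) hε.le)]
    calc _ ≤ (b - a) / ε * (C * ε) :=
          mul_le_mul_of_nonneg_left (hP _) (div_nonneg (sub_nonneg.2 hab) hε.le)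
      _ = _ := by field_simp
  -- The path goes from `a` to the next node, along nodes, then from the last node to `b`; the three
  -- time lengths add up to `b - a`.
  · have h1 := norm_interpolate_sub_floor_succ_le hε hP a
    have h2 := norm_sub_le_of_norm_succ_sub_le hP (Nat.succ_le_of_lt hlt)
    have h3 := norm_interpolate_sub_floor_le hε hP (ha.trans hab)
    push_cast at h2
    calc ‖interpolate ε P b - interpolate ε P a‖
        = ‖(interpolate ε P b - P ⌊b / ε⌋₊) + (P ⌊b / ε⌋₊ - P (⌊a / ε⌋₊ + 1))
            + (P (⌊a / ε⌋₊ + 1) - interpolate ε P a)‖ := by congr 1; abel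
      _ ≤ _ := norm_add₃_le
      _ ≤ C * (b - ε * ⌊b / ε⌋₊) + C * ε * (⌊b / ε⌋₊ - (⌊a / ε⌋₊ + 1))
            + C * (ε * (⌊a / ε⌋₊ + 1) - a) := by gcongr
      _ = C * (b - a) := by ring

theorem interpolate_zero (ε : ℝ) (P : ℕ → E) : interpolate ε P 0 = P 0 := by
  simp [interpolate]

/-- Paths are controlled only on `[0, ∞)`. Extending them by a constant to the left allows theorems
about Lipschitz functions on the whole line. -/
theorem lipschitzWith_comp_max_zero {F : Type*} [NormedAddCommGroup F]
    {x : ℝ → F} {C : ℝ≥0}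
    (hx : ∀ a b, 0 ≤ a → a ≤ b → ‖x b - x a‖ ≤ C * (b - a)) :
    LipschitzWith C fun τ => x (max τ 0) := by
  have key : ∀ a b : ℝ, a ≤ b → dist (x (max a 0)) (x (max b 0)) ≤ C * dist a b := by
    intro a b hab
    rw [dist_comm, dist_eq_norm, dist_comm a b, Real.dist_eq, abs_of_nonneg (sub_nonneg.2 hab)]
    refine (hx _ _ (le_max_right a 0) (max_le_max_right 0 hab)).trans ?_
    refine mul_le_mul_of_nonneg_left ?_ C.2
    simpa [hab] using max_sub_max_le_max b 0 a 0
  refine LipschitzWith.of_dist_le_mul fun a b => ?_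
  rcases le_total a b with hab | hab
  · exact key a b hab
  · rw [dist_comm, dist_comm a b]
    exact key b a hab

theorem tendsto_mul_floor_div {ε : ℕ → ℝ} (hε : ∀ k, 0 < ε k) (hε0 : Tendsto ε atTop (𝓝 0))
    {s : ℝ} (hs : 0 ≤ s) :
    Tendsto (fun k => ε k * ⌊s / ε k⌋₊) atTop (𝓝 s) := by
  have hlow : Tendsto (fun k => s - ε k) atTop (𝓝 s) := by
    simpa using tendsto_const_nhds.sub hε0
  refine tendsto_of_tendsto_of_tendsto_of_le_of_le hlow tendsto_const_nhds (fun k => ?_)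
    fun k => ?_
  · have h := Nat.lt_floor_add_one (s / ε k)
    rw [div_lt_iff₀ (hε k)] at h
    show s - ε k ≤ ε k * ⌊s / ε k⌋₊
    linarith
  · have h := Nat.floor_le (div_nonneg hs (hε k).le)
    rw [le_div_iff₀ (hε k)] at h
    show ε k * ⌊s / ε k⌋₊ ≤ s
    linarith

theorem tendsto_node_of_tendsto_interpolate {ε : ℕ → ℝ} {P : ℕ → ℕ → E} {C : ℝ}
    (hε : ∀ k, 0 < ε k) (hε0 : Tendsto ε atTop (𝓝 0))
    (hP : ∀ k t, ‖P k (t + 1) - P k t‖ ≤ C * ε k) {s : ℝ} (hs : 0 ≤ s) {v : E}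
    (hv : Tendsto (fun k => interpolate (ε k) (P k) s) atTop (𝓝 v)) :
    Tendsto (fun k => P k ⌊s / ε k⌋₊) atTop (𝓝 v) := by
  have hz : Tendsto (fun k => interpolate (ε k) (P k) s - P k ⌊s / ε k⌋₊) atTop (𝓝 0) := by
    refine squeeze_zero_norm (fun k => norm_interpolate_sub_floor_le (hε k) (hP k) hs) ?_
    simpa using ((tendsto_mul_floor_div hε hε0 hs).const_sub s).const_mul C
  simpa using hv.sub hz

/-- By telescoping, the mean velocity is the average of the `y t` with equal weights `1 / (b - a)`.
-/
theorem IsRecursiveInclusion.slope_mem {g : E → Set E} {ε : ℝ} {P : ℕ → E} {K : Set E}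
    (hP : IsRecursiveInclusion g ε P) (hε : 0 < ε) (hK : Convex ℝ K) {a b : ℕ} (hab : a < b)
    (hg : ∀ t, a ≤ t → t < b → g (P t) ⊆ K) :
    (ε * (b - a : ℝ))⁻¹ • (P b - P a) ∈ K := by
  obtain ⟨y, hy⟩ := hP
  have hsum : P b - P a = ε • ∑ t ∈ Finset.Ico a b, y t := by
    rw [← Finset.sum_Ico_sub P hab.le, Finset.smul_sum]
    refine Finset.sum_congr rfl fun t _ => ?_
    rw [(hy t).2, add_sub_cancel_left]
  have hba : (0 : ℝ) < b - a := sub_pos.2 (Nat.cast_lt.2 hab)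
  have hrw : (ε * (b - a : ℝ))⁻¹ • (P b - P a) = ∑ t ∈ Finset.Ico a b, (b - a : ℝ)⁻¹ • y t := by
    rw [hsum, smul_smul, ← Finset.smul_sum]
    congr 1
    field_simp
  rw [hrw]
  refine hK.sum_mem (fun _ _ => (inv_pos.2 hba).le) ?_ fun t ht => ?_
  · rw [Finset.sum_const, Nat.card_Ico, nsmul_eq_mul, Nat.cast_sub hab.le]
    exact mul_inv_cancel₀ hba.ne'
  · obtain ⟨h1, h2⟩ := Finset.mem_Ico.1 ht
    exact hg t h1 h2 (hy t).1

/-! ### Limits of interpolated trajectories -/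

section Limit

variable {h : E → E} {C : ℝ≥0} {ε : ℕ → ℝ} {P : ℕ → ℕ → E} {x : ℝ → E}

theorem norm_sub_le_of_tendsto_interpolate (hε : ∀ k, 0 < ε k)
    (hP : ∀ k t, ‖P k (t + 1) - P k t‖ ≤ C * ε k)
    (hx : ∀ s, 0 ≤ s → Tendsto (fun k => interpolate (ε k) (P k) s) atTop (𝓝 (x s)))
    {a b : ℝ} (ha : 0 ≤ a) (hab : a ≤ b) : ‖x b - x a‖ ≤ C * (b - a) :=
  le_of_tendsto ((hx b (ha.trans hab)).sub (hx a ha)).norm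
    (Eventually.of_forall fun k => norm_interpolate_sub_le (hε k) (hP k) ha hab)

theorem slope_mem_closedConvexHull_of_tendsto_interpolate (hC : ∀ p, ‖h p‖ ≤ C)
    (hε : ∀ k, 0 < ε k) (hε0 : Tendsto ε atTop (𝓝 0))
    (hP : ∀ k, IsRecursiveInclusion (regularization h) (ε k) (P k))
    (hx : ∀ s, 0 ≤ s → Tendsto (fun k => interpolate (ε k) (P k) s) atTop (𝓝 (x s)))
    {τ δ γ : ℝ} (hτ : 0 ≤ τ) (hδ : 0 < δ) (hγ : C * δ < γ) :
    δ⁻¹ • (x (τ + δ) - x τ) ∈ closedConvexHull ℝ (h '' Metric.ball (x τ) γ) := by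
  have hstep : ∀ k t, ‖P k (t + 1) - P k t‖ ≤ C * ε k := fun k t =>
    (hP k).norm_succ_sub_le hC (hε k) t
  have hτδ : 0 ≤ τ + δ := by linarith
  have ha := tendsto_node_of_tendsto_interpolate hε hε0 hstep hτ (hx τ hτ)
  have hb := tendsto_node_of_tendsto_interpolate hε hε0 hstep hτδ (hx _ hτδ)
  have hlen : Tendsto (fun k => ε k * (⌊(τ + δ) / ε k⌋₊ - ⌊τ / ε k⌋₊ : ℝ)) atTop (𝓝 δ) := by
    simpa [mul_sub] using
      (tendsto_mul_floor_div hε hε0 hτδ).sub (tendsto_mul_floor_div hε hε0 hτ)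
  -- Distance of the window's nodes from `x τ`: the length travelled since the first node, plus the
  -- error of that node.
  have hrad : Tendsto (fun k => C * (ε k * (⌊(τ + δ) / ε k⌋₊ - ⌊τ / ε k⌋₊ : ℝ))
      + dist (P k ⌊τ / ε k⌋₊) (x τ)) atTop (𝓝 (C * δ)) := by
    simpa using (hlen.const_mul (C : ℝ)).add (tendsto_iff_dist_tendsto_zero.1 ha)
  refine isClosed_closedConvexHull.mem_of_tendsto ((hlen.inv₀ hδ.ne').smul (hb.sub ha)) ?_
  filter_upwards [hrad.eventually_lt_const hγ, hlen.eventually_const_lt hδ] with k hk hpos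
  have hlt : ⌊τ / ε k⌋₊ < ⌊(τ + δ) / ε k⌋₊ := by
    exact_mod_cast sub_pos.1 (pos_of_mul_pos_right hpos (hε k).le)
  refine (hP k).slope_mem (hε k) convex_closedConvexHull hlt fun t hat htb => ?_
  refine regularization_subset_closedConvexHull h (lt_of_le_of_lt ?_ hk)
  refine (dist_triangle _ (P k ⌊τ / ε k⌋₊) _).trans (add_le_add_left ?_ _)
  rw [dist_eq_norm]
  refine (norm_sub_le_of_norm_succ_sub_le (hstep k) hat).trans ?_
  rw [mul_assoc]
  have := (hε k).le
  gcongr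

/-- For fixed `γ`, all right slopes over short enough windows lie in the same closed hull, hence so
does their limit. -/
theorem hasDerivAt_mem_regularization_of_tendsto_interpolate (hC : ∀ p, ‖h p‖ ≤ C)
    (hε : ∀ k, 0 < ε k) (hε0 : Tendsto ε atTop (𝓝 0))
    (hP : ∀ k, IsRecursiveInclusion (regularization h) (ε k) (P k))
    (hx : ∀ s, 0 ≤ s → Tendsto (fun k => interpolate (ε k) (P k) s) atTop (𝓝 (x s)))
    {τ : ℝ} (hτ : 0 ≤ τ) {v : E} (hv : HasDerivAt x v τ) : v ∈ regularization h (x τ) := by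
  refine Set.mem_iInter₂.2 fun γ hγ => ?_
  refine isClosed_closedConvexHull.mem_of_tendsto hv.tendsto_slope_zero_right ?_
  have hsmall : ∀ᶠ δ : ℝ in 𝓝[>] 0, C * δ < γ := by
    have hlim : Tendsto (fun δ : ℝ => C * δ) (𝓝[>] 0) (𝓝 0) := by
      simpa using ((continuous_const_mul (C : ℝ)).tendsto 0).mono_left nhdsWithin_le_nhds
    exact hlim.eventually_lt_const hγ
  filter_upwards [hsmall, self_mem_nhdsWithin] with δ hδγ hδ
  exact slope_mem_closedConvexHull_of_tendsto_interpolate hC hε hε0 hP hx hτ hδ hδγ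

theorem isDifferentialInclusionSolution_of_tendsto_interpolate [FiniteDimensional ℝ E]
    (hC : ∀ p, ‖h p‖ ≤ C) (hε : ∀ k, 0 < ε k) (hε0 : Tendsto ε atTop (𝓝 0))
    (hP : ∀ k, IsRecursiveInclusion (regularization h) (ε k) (P k))
    (hx : ∀ s, 0 ≤ s → Tendsto (fun k => interpolate (ε k) (P k) s) atTop (𝓝 (x s))) :
    IsDifferentialInclusionSolution (regularization h) x := by
  have hlip : LipschitzWith C fun τ => x (max τ 0) :=
    lipschitzWith_comp_max_zero fun a b ha hab =>
      norm_sub_le_of_tendsto_interpolate hε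
        (fun k t => (hP k).norm_succ_sub_le hC (hε k) t) hx ha hab
  refine ⟨fun T hT => ?_, ?_⟩
  · refine LipschitzOnWith.absolutelyContinuousOnInterval (K := C) ?_
    intro a ha b hb
    rw [Set.uIcc_of_le hT.le] at ha hb
    simpa [max_eq_left ha.1, max_eq_left hb.1] using hlip a b
  -- Time `0` is discarded: `x` is arbitrary on negative times, so its two-sided derivative there is
  -- not controlled.
  · rw [← restrict_Ioi_eq_restrict_Ici, ae_restrict_iff' measurableSet_Ioi]
    filter_upwards [hlip.ae_differentiableAt_real] with τ hd hτ
    have hd' : HasDerivAt x (deriv (fun τ => x (max τ 0)) τ) τ := by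
      refine hd.hasDerivAt.congr_of_eventuallyEq ?_
      filter_upwards [Ioi_mem_nhds hτ] with s hs
      rw [max_eq_left (le_of_lt hs)]
    exact ⟨_, hasDerivAt_mem_regularization_of_tendsto_interpolate hC hε hε0 hP hx
      (le_of_lt hτ) hd', hd'⟩

end Limit

/-! ### Compactness of families of Lipschitz paths -/

theorem isCompact_setOf_lipschitzWith_of_bounded {F : Type*} [NormedAddCommGroup F]
    [ProperSpace F] (C : ℝ≥0) (R : ℝ) :
    IsCompact {f : C(ℝ, F) | LipschitzWith C f ∧ ‖f 0‖ ≤ R} := by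
  refine ArzelaAscoli.isCompact_of_equicontinuous _ ?_ ?_
  -- Lipschitz functions are continuous, so the image is cut out by pointwise closed conditions
  -- inside a product of closed balls, which is compact by Tychonoff.
  · have himg : ContinuousMap.toFun '' {f : C(ℝ, F) | LipschitzWith C f ∧ ‖f 0‖ ≤ R}
        = {f : ℝ → F | LipschitzWith C f} ∩ {f | ‖f 0‖ ≤ R} := by
      ext f
      refine ⟨?_, fun hf => ⟨⟨f, hf.1.continuous⟩, hf, rfl⟩⟩
      rintro ⟨f, hf, rfl⟩
      exact hf
    rw [himg]
    refine IsCompact.of_isClosed_subset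
      (isCompact_univ_pi fun τ : ℝ => isCompact_closedBall (0 : F) (C * |τ| + R))
      ((isClosed_setOfPred_lipschitzWith C).inter
        (isClosed_le (continuous_apply (0 : ℝ)).norm continuous_const)) ?_
    rintro f ⟨hf, hf0⟩ τ -
    have h1 : ‖f τ - f 0‖ ≤ C * |τ| := by
      simpa [dist_eq_norm] using hf.dist_le_mul τ 0
    have h2 : ‖f τ‖ ≤ ‖f τ - f 0‖ + ‖f 0‖ := by
      simpa using norm_add_le (f τ - f 0) (f 0)
    rw [mem_closedBall_zero_iff]
    exact h2.trans (add_le_add h1 hf0)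
  · exact (LipschitzWith.uniformEquicontinuous _ C fun f => f.2.1).equicontinuous

theorem exists_pathTendsto_subseq_of_lipschitz {F : Type*} [NormedAddCommGroup F]
    [ProperSpace F] {X : ℕ → ℝ → F} {C : ℝ≥0}
    (hX : ∀ k a b, 0 ≤ a → a ≤ b → ‖X k b - X k a‖ ≤ C * (b - a))
    (hbd : Bornology.IsBounded (Set.range fun k => X k 0)) :
    ∃ (φ : ℕ → ℕ) (x : ℝ → F), StrictMono φ ∧ PathTendsto (fun k => X (φ k)) x := by
  obtain ⟨R, hR⟩ := hbd.exists_norm_le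
  have hlip : ∀ k, LipschitzWith C fun τ => X k (max τ 0) := fun k =>
    lipschitzWith_comp_max_zero (hX k)
  let f : ℕ → C(ℝ, F) := fun k => ⟨fun τ => X k (max τ 0), (hlip k).continuous⟩
  have hF : ∀ k, f k ∈ {f : C(ℝ, F) | LipschitzWith C f ∧ ‖f 0‖ ≤ R} := fun k =>
    ⟨hlip k, by simpa [f] using hR _ (Set.mem_range_self k)⟩
  obtain ⟨x, -, φ, hφ, hlim⟩ := (isCompact_setOf_lipschitzWith_of_bounded C R).tendsto_subseq hF
  refine ⟨φ, x, hφ, fun T _ => ?_⟩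
  refine (ContinuousMap.tendsto_iff_forall_isCompact_tendstoUniformlyOn.1 hlim _
    isCompact_Icc).congr (Eventually.of_forall fun k τ hτ => ?_)
  simp [f, max_eq_left hτ.1]

theorem isLimitingDifferentialInclusion_regularization [FiniteDimensional ℝ E] {h : E → E}
    {C : ℝ} (hC : ∀ p, ‖h p‖ ≤ C) :
    IsLimitingDifferentialInclusion (regularization h) (regularization h) := by
  intro ε P hε hε0 hP
  lift C to ℝ≥0 using (norm_nonneg _).trans (hC 0)
  refine ⟨fun x hx => ?_, fun hbd => ?_⟩
  · refine isDifferentialInclusionSolution_of_tendsto_interpolate hC hε hε0 hP fun s hs => ?_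
    -- The horizon `s + 1` is positive even when `s = 0`.
    exact (hx (s + 1) (by linarith)).tendsto_at ⟨hs, by linarith⟩
  · have : ProperSpace E := FiniteDimensional.proper ℝ E
    refine exists_pathTendsto_subseq_of_lipschitz
      (X := fun k => interpolate (ε k) (P k)) (C := C) (fun k a b ha hab => ?_) ?_
    · exact norm_interpolate_sub_le (hε k)
        (fun t => (hP k).norm_succ_sub_le hC (hε k) t) ha hab
    · simpa only [interpolate_zero] using hbd

end Dynamics

/-! ### Boundedness of the update direction -/

namespace HetNet

variable {n : ℕ} (net : HetNet n)

theorem outage_nonneg (P : Param n) (s : Fin (n + 1)) : 0 ≤ net.outage P s := by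
  unfold outage; positivity

theorem outage_le_one (P : Param n) (s : Fin (n + 1)) : net.outage P s ≤ 1 := by
  classical
  unfold outage
  -- This also covers a cell without users, where the quotient is `0 / 0 = 0`.
  refine div_le_one_of_le₀ ?_ (by positivity)
  calc _ ≤ ((net.cellUsers P s ×ˢ (Finset.univ : Finset (Fin net.numPRB))).card : ℝ) :=
        Nat.cast_le.2 (Finset.card_filter_le _ _)
    _ = _ := by simp [Finset.card_product]

/-- A difference of two loads in `[0, 1]` is at most `1` in absolute value; in the other branch the
outage shifts the threshold by at most `1`. -/
theorem abs_drift_le (hload : ∀ P s, net.ulLoad P s ≤ 1) (P : Param n) (s : Fin n) :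
    |net.drift P s| ≤ |net.outageThreshold| + 1 := by
  have hl : ∀ s, 0 ≤ (net.ulLoad P s).toReal ∧ (net.ulLoad P s).toReal ≤ 1 := fun s =>
    ⟨ENNReal.toReal_nonneg, ENNReal.toReal_le_of_le_ofReal zero_le_one (by simpa using hload P s)⟩
  have h0 := hl 0
  have hs := hl s.succ
  have ho := net.outage_nonneg P s.succ
  have ho' := net.outage_le_one P s.succ
  have ht := abs_le.1 (le_refl |net.outageThreshold|)
  simp only [drift]
  split_ifs <;> rw [abs_le] <;> constructor <;> linarith [abs_nonneg net.outageThreshold]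

theorem norm_drift_le (hload : ∀ P s, net.ulLoad P s ≤ 1) (P : Param n) :
    ‖net.drift P‖ ≤ √(n * (|net.outageThreshold| + 1) ^ 2) := by
  rw [EuclideanSpace.norm_eq]
  refine Real.sqrt_le_sqrt ?_
  calc ∑ s, ‖net.drift P s‖ ^ 2 ≤ ∑ _s : Fin n, (|net.outageThreshold| + 1) ^ 2 :=
        Finset.sum_le_sum fun s _ => by
          gcongr
          exact net.abs_drift_le hload P s
    _ = _ := by simp

end HetNet

theorem proposition1 {n : ℕ} (net : HetNet n)
    (hload : ∀ (P : Param n) (s : Fin (n + 1)), net.ulLoad P s ≤ 1) :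
    (∀ P : Param n, net.drift P ∈ regularization net.drift P) ∧
    (∀ (ε : ℝ) (P : ℕ → Param n), IsIteration net.drift ε P →
      IsRecursiveInclusion (regularization net.drift) ε P) ∧
    IsLimitingDifferentialInclusion (regularization net.drift) (regularization net.drift) :=
  ⟨mem_regularization_self net.drift, fun _ _ hP => hP.isRecursiveInclusion,
    isLimitingDifferentialInclusion_regularization (net.norm_drift_le hload)⟩
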